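/- **Definitions.** A poset is *wqo* if it has no infinite antichain and no infinite strictly decreasing sequence. A *barrier* is an infinite family $B$ of finite subsets of $\omega$ which is an antichain under inclusion and such that every infinite subset of $\bigcup B$ has an initial segment in $B$; its *type* is its order type under the lexicographic order. For finite sets $r,s\subseteq\omega$ write $r\triangleleft s$ if $r,s\neq\emptyset$, $\min r<\min s$ and $r\setminus\{\min r\}$ is a proper initial segment of $s$. For $\alpha<\omega_1$, a poset $P$ is *$\alpha$-wqo* if for every barrier $B$ of type at most $\alpha$ and every map $f:B\to P$ there are $s,t\in B$ with $s\triangleleft t$ and $f(s)\le f(t)$; $P$ is *bqo* if it is $\alpha$-wqo for all $\alpha<\omega_1$. Call $P$ *$\sigma$-bqo* if $P=\bigcup_{n<\omega}P_n$ where each $P_n$, with the induced order, is bqo. For sequences $s:\beta\to P$ and $t:\gamma\to P$ indexed by ordinals, let $s\le t$ if there is a strictly increasing $\rho:\beta\to\gamma$ with $s(i)\le_P t(\rho(i))$ for all $i<\beta$. Let $P^\alpha$ (respectively $P^{<\alpha}$) be the poset obtained from the sequences of length $\alpha$ (respectively of length less than $\alpha$) from $P$, quasi-ordered in this way, by identifying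 $s$ and $t$ whenever $s\le t\le s$. For a poset $Q$, let $I(Q)$ be the set of its initial segments (downward closed subsets), ordered by inclusion. **Theorem.** Let $1\le\alpha<\omega_1$ and let $P$ be a $\sigma$-bqo poset such that $P^\alpha$ is wqo. Then $P^{<\alpha}$ is wqo, and $P^{<\alpha}$, $I(P^{<\alpha})$ and $P^\alpha$ are all $\sigma$-bqo. -/

import Mathlib

open scoped Ordinal

universe u

/-- `s` is an initial segment of the set `X` of natural numbers. -/
def IsInitialSegment (s : Finset ℕ) (X : Set ℕ) : Prop :=
  (s : Set ℕ) ⊆ X ∧ ∀ x ∈ X, ∀ y ∈ s, x ≤ y → x ∈ s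

/-- The base of a family of finite sets of natural numbers: its union. -/
def barrierBase (B : Set (Finset ℕ)) : Set ℕ := ⋃ s ∈ B, (s : Set ℕ)

/-- A barrier: an infinite family of finite subsets of `ℕ` that is an antichain under inclusion and
such that every infinite subset of its base has an initial segment in the family. -/
structure IsBarrier (B : Set (Finset ℕ)) : Prop where
  infinite : B.Infinite
  antichain : IsAntichain (· ⊆ ·) B
  exists_initial : ∀ X : Set ℕ, X ⊆ barrierBase B → X.Infinite → ∃ s ∈ B, IsInitialSegment s X

/-- Shift-extension `r ◁ s`: `min r < min s`, and `r` without its minimum is a proper initial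
segment of `s`. -/
def ShiftExtends (r s : Finset ℕ) : Prop :=
  ∃ (hr : r.Nonempty) (hs : s.Nonempty), r.min' hr < s.min' hs ∧
    IsInitialSegment (r.erase (r.min' hr)) (s : Set ℕ) ∧ r.erase (r.min' hr) ≠ s

/-- The lexicographic order on a family of finite sets of natural numbers, each set being
identified with its increasing enumeration. -/
def barrierLex (B : Set (Finset ℕ)) (s t : B) : Prop :=
  (s : Finset ℕ).sort (· ≤ ·) < (t : Finset ℕ).sort (· ≤ ·)

/-- The lexicographic order on `B` is a well order of order type at most `α`. -/
def BarrierTypeLE (B : Set (Finset ℕ)) (α : Ordinal.{0}) : Prop :=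
  ∃ _ : IsWellOrder B (barrierLex B), Ordinal.type (barrierLex B) ≤ α

/-- A map `f` from a family of finite sets to an ordered set is good if `f s ≤ f t` for some
`s ◁ t`. -/
def IsGood {P : Type u} [LE P] {B : Set (Finset ℕ)} (f : B → P) : Prop :=
  ∃ s t : B, ShiftExtends (s : Finset ℕ) (t : Finset ℕ) ∧ f s ≤ f t

/-- `P` is `α`-wqo: every map from a barrier of order type at most `α` to `P` is good. -/
def IsAlphaWqo (P : Type u) [LE P] (α : Ordinal.{0}) : Prop :=
  ∀ B : Set (Finset ℕ), IsBarrier B → BarrierTypeLE B α → ∀ f : B → P, IsGood f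

/-- `P` is a better quasi order: it is `α`-wqo for every countable ordinal `α`. -/
def IsBqo (P : Type u) [LE P] : Prop := ∀ α : Ordinal.{0}, α < ω₁ → IsAlphaWqo P α

/-- `P` is `σ`-bqo: it is a union of countably many subsets each of which is bqo in the induced
order. -/
def IsSigmaBqo (P : Type u) [LE P] : Prop :=
  ∃ S : ℕ → Set P, (⋃ n, S n) = Set.univ ∧ ∀ n, IsBqo (S n)

/-- Embeddability of ordinal-indexed sequences. -/
def SeqEmbeds {P : Type u} [LE P] {β γ : Ordinal.{0}} (s : Set.Iio β → P) (t : Set.Iio γ → P) :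
    Prop :=
  ∃ ρ : Set.Iio β → Set.Iio γ, StrictMono ρ ∧ ∀ i, s i ≤ t (ρ i)

theorem SeqEmbeds.refl {P : Type u} [Preorder P] {β : Ordinal.{0}} (s : Set.Iio β → P) :
    SeqEmbeds s s :=
  ⟨id, strictMono_id, fun _ => le_rfl⟩

theorem SeqEmbeds.trans {P : Type u} [Preorder P] {β γ δ : Ordinal.{0}} {s : Set.Iio β → P}
    {t : Set.Iio γ → P} {v : Set.Iio δ → P} (h : SeqEmbeds s t) (k : SeqEmbeds t v) :
    SeqEmbeds s v := by
  obtain ⟨ρ, hρ, h⟩ := h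
  obtain ⟨τ, hτ, k⟩ := k
  exact ⟨τ ∘ ρ, hτ.comp hρ, fun i => (h i).trans (k (ρ i))⟩

/-- The sequences of length `α` from `P`. -/
structure OrdSeq (P : Type u) (α : Ordinal.{0}) where
  val : Set.Iio α → P

/-- The sequences of length less than `α` from `P`. -/
structure OrdSeqLT (P : Type u) (α : Ordinal.{0}) where
  length : Ordinal.{0}
  length_lt : length < α
  val : Set.Iio length → P

instance {P : Type u} [Preorder P] {α : Ordinal.{0}} : Preorder (OrdSeq P α) where
  le s t := SeqEmbeds s.val t.val
  le_refl s := SeqEmbeds.refl s.val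
  le_trans _ _ _ h k := SeqEmbeds.trans h k

instance {P : Type u} [Preorder P] {α : Ordinal.{0}} : Preorder (OrdSeqLT P α) where
  le s t := SeqEmbeds s.val t.val
  le_refl s := SeqEmbeds.refl s.val
  le_trans _ _ _ h k := SeqEmbeds.trans h k

/-- The poset `P^α`: `α`-sequences under embeddability, modulo mutual embeddability. -/
abbrev OrdPow (P : Type u) [Preorder P] (α : Ordinal.{0}) :=
  Antisymmetrization (OrdSeq P α) (· ≤ ·)

/-- The poset `P^{<α}`: sequences of length less than `α` under embeddability, modulo mutual
embeddability. -/
abbrev OrdPowLT (P : Type u) [Preorder P] (α : Ordinal.{0}) :=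
  Antisymmetrization (OrdSeqLT P α) (· ≤ ·)

/-!
The proof has two independent halves.

*Well quasi ordering of `P^{<α}`.* Since `α ≥ 1`, the constant sequences show that `P` is wqo; let
`w` be a minimal element. Write a sequence `s` of length less than `α` as a core followed by its
longest tail with constant value `w`, and pad `s` to length `α` with further values `w`. If the
padding of `s` embeds into that of `t`, then the core of `s` lands in the core of `t`: otherwise all
terms of `s` from some position in its core on would be at most `w`, hence equal to `w`. If in
addition the constant tail of `s` is no longer than that of `t`, then `s` embeds into `t`
(`seqEmbeds_of_padSeq_le`). So `P^{<α}` maps, reflecting the order, into the product of `P^α` and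
the ordinals, which is wqo.

*The `σ`-bqo property.* The class of `σ`-bqos is closed under order-reflecting preimages, countable
unions and finite products; the last rests on the fact that a product of two bqos is bqo, which
follows from the Nash-Williams–Galvin partition theorem (`exists_infinite_homogeneous`,
`IsBqo.prod`). If `Q` is wqo and `σ`-bqo, then `I(Q)` is `σ`-bqo, as every lower set is the
complement of the upper closure of a tuple `(q₁, …, qₖ)` and the order of lower sets is reflected by
the coordinatewise order of such tuples (`IsSigmaBqo.lowerSet`). Now `P^γ` is `σ`-bqo for all
`γ ≤ α` by induction on `γ` (`isSigmaBqo_ordSeq`). For a successor, `P^{δ+1}` reflects into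
`P^δ × P`. For a limit, embeddability is compact: if all proper initial segments of `s` embed into
`t`, then so does `s` (`seqEmbeds_of_forall_initial`). Hence `P^γ` reflects into `I(P^{<γ})`, and
`P^{<γ}` is wqo and, as a countable union of powers of smaller exponent, `σ`-bqo.
-/

/-! ### The Nash-Williams–Galvin partition theorem -/

theorem IsInitialSegment.subset_or_subset {s t : Finset ℕ} {X : Set ℕ} (hs : IsInitialSegment s X)
    (ht : IsInitialSegment t X) : s ⊆ t ∨ t ⊆ s := by
  by_contra! h
  obtain ⟨⟨a, has, hat⟩, ⟨b, hbt, hbs⟩⟩ := And.imp Finset.not_subset.1 Finset.not_subset.1 h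
  rcases le_total a b with hab | hab
  · exact hat (ht.2 a (hs.1 has) b hbt hab)
  · exact hbs (hs.2 b (ht.1 hbt) a has hab)

theorem IsInitialSegment.trans {s t : Finset ℕ} {X : Set ℕ} (hs : IsInitialSegment s (t : Set ℕ))
    (ht : IsInitialSegment t X) : IsInitialSegment s X :=
  ⟨hs.1.trans ht.1, fun x hx y hy hxy => hs.2 x (ht.2 x hx y (hs.1 hy) hxy) y hy hxy⟩

/-- The elements of `Y` above all elements of `u`. -/
def elementsAbove (u : Finset ℕ) (Y : Set ℕ) : Set ℕ := {y ∈ Y | ∀ a ∈ u, a < y}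

theorem elementsAbove_subset (u : Finset ℕ) (Y : Set ℕ) : elementsAbove u Y ⊆ Y := fun _ h => h.1

theorem Set.Infinite.elementsAbove {Y : Set ℕ} (hY : Y.Infinite) (u : Finset ℕ) :
    (elementsAbove u Y).Infinite := by
  refine (hY.sdiff (Set.finite_Iic (u.sup id))).mono fun y hy => ⟨hy.1, fun a ha => ?_⟩
  exact (Finset.le_sup (f := id) ha).trans_lt (not_le.1 hy.2)

theorem isInitialSegment_union_elementsAbove (u : Finset ℕ) (Y : Set ℕ) :
    IsInitialSegment u ((u : Set ℕ) ∪ elementsAbove u Y) := by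
  refine ⟨Set.subset_union_left, fun x hx y hy hxy => ?_⟩
  rcases hx with hx | hx
  · exact hx
  · exact absurd (hx.2 y hy) (not_lt.2 hxy)

/-- Fusion: if `Φ s` is inherited by infinite subsets and can be forced by shrinking, then a single
infinite set satisfies all the conditions `Φ s` at once, each above `s`. -/
theorem exists_fusion (Φ : Finset ℕ → Set ℕ → Prop)
    (mono : ∀ s M M', M' ⊆ M → M'.Infinite → Φ s M → Φ s M')
    (dense : ∀ s (M : Set ℕ), M.Infinite → ∃ M' ⊆ M, M'.Infinite ∧ Φ s M')
    {X : Set ℕ} (hX : X.Infinite) :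
    ∃ N ⊆ X, N.Infinite ∧ ∀ s : Finset ℕ, (s : Set ℕ) ⊆ N → Φ s (elementsAbove s N) := by
  have many (F : Finset (Finset ℕ)) :
      ∀ M : Set ℕ, M.Infinite → ∃ M' ⊆ M, M'.Infinite ∧ ∀ s ∈ F, Φ s M' := by
    induction F using Finset.induction_on with
    | empty => exact fun M hM => ⟨M, subset_rfl, hM, by simp⟩
    | insert s F _ ih =>
      intro M hM
      obtain ⟨M₁, h₁, hi₁, hΦ₁⟩ := ih M hM
      obtain ⟨M₂, h₂, hi₂, hΦ₂⟩ := dense s M₁ hi₁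
      refine ⟨M₂, h₂.trans h₁, hi₂, fun r hr => ?_⟩
      rcases Finset.mem_insert.1 hr with rfl | hr
      · exact hΦ₂
      · exact mono r M₁ M₂ h₂ hi₂ (hΦ₁ r hr)
  -- since the least element of `M` bounds the elements chosen so far, it suffices to satisfy the
  -- finitely many conditions indexed by sets below it
  have step (M : {M : Set ℕ // M.Infinite}) : ∃ M' : {M : Set ℕ // M.Infinite},
      M'.1 ⊆ M.1 ∧ (∀ x ∈ M'.1, sInf M.1 < x) ∧
        ∀ s : Finset ℕ, s ⊆ Finset.range (sInf M.1 + 1) → Φ s M'.1 := by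
    obtain ⟨M', h, hi, hΦ⟩ := many (Finset.range (sInf M.1 + 1)).powerset _
      (M.2.elementsAbove {sInf M.1})
    exact ⟨⟨M', hi⟩, h.trans (elementsAbove_subset _ _), fun x hx => (h hx).2 _ (by simp),
      fun s hs => hΦ s (by simpa using hs)⟩
  choose next hsub hlt hΦ using step
  obtain ⟨M₀, h₀, hi₀, hΦ₀⟩ := dense ∅ X hX
  let M : ℕ → {M : Set ℕ // M.Infinite} := fun k => next^[k] ⟨M₀, hi₀⟩
  have hM (k) : M (k + 1) = next (M k) := Function.iterate_succ_apply' ..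
  have anti : Antitone fun k => (M k).1 := antitone_nat_of_succ_le fun k => by
    rw [hM]; exact hsub _
  let n : ℕ → ℕ := fun k => sInf (M k).1
  have hn (k) : n k ∈ (M k).1 := Nat.sInf_mem (M k).2.nonempty
  have nmono : StrictMono n := strictMono_nat_of_lt_succ fun k =>
    hlt (M k) _ (by rw [← hM]; exact hn (k + 1))
  have hN : Set.range n ⊆ M₀ := by
    rintro _ ⟨k, rfl⟩
    exact anti (Nat.zero_le k) (hn k)
  refine ⟨Set.range n, hN.trans h₀, Set.infinite_range_of_injective nmono.injective,
    fun s hs => ?_⟩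
  have hinf := (Set.infinite_range_of_injective nmono.injective).elementsAbove s
  rcases s.eq_empty_or_nonempty with rfl | hne
  · exact mono _ _ _ ((elementsAbove_subset _ _).trans hN) hinf hΦ₀
  · obtain ⟨k, hk⟩ := hs (s.max'_mem hne)
    refine mono s (M (k + 1)).1 _ ?_ hinf (by
      rw [hM]
      refine hΦ _ s fun a ha => ?_
      have := s.le_max' a ha
      rw [← hk] at this
      exact Finset.mem_range.2 (Nat.lt_succ_of_le this))
    rintro _ ⟨⟨l, rfl⟩, hl⟩
    have hkl : n k < n l := by rw [hk]; exact hl _ (s.max'_mem hne)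
    exact anti (nmono.lt_iff_lt.1 hkl) (hn l)

/-- The Nash-Williams–Galvin theorem: for every family `F` of finite sets, every infinite set `X`
has an infinite subset `Y` such that either no infinite subset of `Y` has an initial segment in `F`,
or all of them have one. The proof is by combinatorial forcing: `M` accepts `s` if every infinite
set consisting of `s` and of later elements of `M` has an initial segment in `F`. -/
theorem exists_infinite_homogeneous (F : Set (Finset ℕ)) {X : Set ℕ} (hX : X.Infinite) :
    ∃ Y ⊆ X, Y.Infinite ∧
      ((∀ Z ⊆ Y, Z.Infinite → ¬ ∃ s ∈ F, IsInitialSegment s Z) ∨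
        ∀ Z ⊆ Y, Z.Infinite → ∃ s ∈ F, IsInitialSegment s Z) := by
  let acc : Finset ℕ → Set ℕ → Prop := fun s M => ∀ Z ⊆ M, Z.Infinite →
    (∀ a ∈ s, ∀ z ∈ Z, a < z) → ∃ u ∈ F, IsInitialSegment u ((s : Set ℕ) ∪ Z)
  let rej : Finset ℕ → Set ℕ → Prop := fun s M => ∀ M' ⊆ M, M'.Infinite → ¬ acc s M'
  have acc_mono {s M M'} (h : M' ⊆ M) (ha : acc s M) : acc s M' := fun Z hZ => ha Z (hZ.trans h)
  have rej_mono {s M M'} (h : M' ⊆ M) (ha : rej s M) : rej s M' := fun Z hZ => ha Z (hZ.trans h)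
  -- shrink `X` to a set `N` that accepts or rejects each of its finite subsets
  obtain ⟨N, hNX, hN, hdec⟩ := exists_fusion (fun s M => acc s M ∨ rej s M)
    (fun s M M' h _ => Or.imp (acc_mono h) (rej_mono h))
    (fun s M hM => by
      by_cases h : rej s M
      · exact ⟨M, subset_rfl, hM, Or.inr h⟩
      · simp only [rej, not_forall, not_not] at h
        obtain ⟨M', h, hi, ha⟩ := h
        exact ⟨M', h, hi, Or.inl ha⟩) hX
  have decides (s : Finset ℕ) (hs : (s : Set ℕ) ⊆ N) : acc s N ∨ rej s N := by
    refine (hdec s hs).imp (fun h Z hZ hi hlt => ?_) (fun h M' hM' hi ha => ?_)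
    · exact h Z (fun z hz => ⟨hZ hz, fun a ha => hlt a ha z hz⟩) hi hlt
    · exact h (elementsAbove s M') (fun z hz => ⟨hM' hz.1, hz.2⟩) (hi.elementsAbove s)
        (acc_mono (elementsAbove_subset _ _) ha)
  rcases decides ∅ (by simp) with h0 | h0
  · exact ⟨N, hNX, hN, Or.inr fun Z hZ hi => by simpa using h0 Z hZ hi (by simp)⟩
  -- if `N` rejects `s`, then it rejects `s ∪ {n}` for almost all `n`
  have fin (s : Finset ℕ) (hr : rej s N) :
      {n ∈ N | (∀ a ∈ s, a < n) ∧ acc (insert n s) N}.Finite := by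
    by_contra hE
    refine hr _ (Set.sep_subset _ _) hE fun Z hZ hi hlt => ?_
    have hm := Nat.sInf_mem hi.nonempty
    set m := sInf Z with hmdef
    have hZm : ∀ z ∈ elementsAbove {m} Z, m < z := fun z hz => hz.2 m (by simp)
    obtain ⟨u, hu, hu'⟩ := (hZ hm).2.2 (elementsAbove {m} Z) (fun z hz => (hZ hz.1).1)
      (hi.elementsAbove _) (by
        intro a ha z hz
        rcases Finset.mem_insert.1 ha with rfl | ha
        · exact hZm z hz
        · exact hlt a ha z hz.1)
    refine ⟨u, hu, ?_⟩
    convert hu' using 1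
    ext z
    simp only [Set.mem_union, Finset.mem_coe, Finset.mem_insert]
    constructor
    · rintro (h | h)
      · exact Or.inl (Or.inr h)
      · rcases (Nat.sInf_le h).eq_or_lt with h' | h'
        · exact Or.inl (Or.inl h'.symm)
        · exact Or.inr ⟨h, by simpa using h'⟩
    · rintro ((rfl | h) | h)
      · exact Or.inr hm
      · exact Or.inl h
      · exact Or.inr h.1
  -- hence `N` can be shrunk to a set `Y` all of whose finite subsets are rejected
  obtain ⟨Y, hYN, hY, hYr⟩ := exists_fusion
    (fun s M => (s : Set ℕ) ⊆ N → rej s N → ∀ n ∈ elementsAbove s M, n ∈ N → rej (insert n s) N)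
    (fun s M M' h _ hM hs hr n hn => hM hs hr n ⟨h hn.1, hn.2⟩)
    (fun s M hM => by
      by_cases hr : rej s N
      · refine ⟨M \ {n ∈ N | (∀ a ∈ s, a < n) ∧ acc (insert n s) N}, Set.sdiff_subset,
          hM.sdiff (fin s hr), fun hs _ n hn hnN => ?_⟩
        refine (decides (insert n s) ?_).resolve_left fun ha => ?_
        · rw [Finset.coe_insert]; exact Set.insert_subset hnN hs
        · exact hn.1.2 ⟨hnN, hn.2, ha⟩
      · exact ⟨M, subset_rfl, hM, fun _ h => absurd h hr⟩) hN
  have rejects (s : Finset ℕ) : (s : Set ℕ) ⊆ Y → rej s N := by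
    induction s using Finset.induction_on_max with
    | empty => exact fun _ => h0
    | insert n s hn ih =>
      intro hs
      rw [Finset.coe_insert, Set.insert_subset_iff] at hs
      exact hYr s hs.2 (hs.2.trans hYN) (ih hs.2) n ⟨⟨hs.1, hn⟩, hn⟩ (hYN hs.1)
  refine ⟨Y, hYN.trans hNX, hY, Or.inl ?_⟩
  rintro Z hZ hi ⟨s, hs, hsZ⟩
  refine rejects s (hsZ.1.trans hZ) N subset_rfl hN fun Z' _ _ hlt => ⟨s, hs, ?_⟩
  refine ⟨Set.subset_union_left, fun x hx y hy hxy => ?_⟩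
  rcases hx with hx | hx
  · exact hx
  · exact absurd (hlt y hy x hx) (not_lt.2 hxy)

/-! ### Barriers -/

theorem IsBarrier.nonempty_of_mem {B : Set (Finset ℕ)} (hB : IsBarrier B) {s : Finset ℕ}
    (hs : s ∈ B) : s.Nonempty := by
  rw [Finset.nonempty_iff_ne_empty]
  rintro rfl
  refine hB.infinite ((Set.finite_singleton ∅).subset fun t ht => ?_)
  exact (hB.antichain.eq hs ht (Finset.empty_subset t)).symm

theorem IsBarrier.infinite_base {B : Set (Finset ℕ)} (hB : IsBarrier B) :
    (barrierBase B).Infinite := fun h => hB.infinite <| by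
  refine h.toFinset.powerset.finite_toSet.subset fun s hs => ?_
  simp only [Finset.coe_powerset, Set.mem_preimage, Set.mem_powerset_iff, Set.Finite.coe_toFinset]
  exact Set.subset_biUnion_of_mem (u := fun s : Finset ℕ => (s : Set ℕ)) hs

theorem IsBarrier.eq_of_isInitialSegment {B : Set (Finset ℕ)} (hB : IsBarrier B) {s t : Finset ℕ}
    (hs : s ∈ B) (ht : t ∈ B) {X : Set ℕ} (hsX : IsInitialSegment s X)
    (htX : IsInitialSegment t X) : s = t := by
  rcases hsX.subset_or_subset htX with h | h
  · exact hB.antichain.eq hs ht h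
  · exact (hB.antichain.eq ht hs h).symm

/-- The members of `B` contained in `Y`. If `B` is a barrier and `Y` is an infinite subset of its
base, this is again a barrier. -/
def barrierRestrict (B : Set (Finset ℕ)) (Y : Set ℕ) : Set (Finset ℕ) := {s ∈ B | (s : Set ℕ) ⊆ Y}

theorem IsBarrier.restrict {B : Set (Finset ℕ)} (hB : IsBarrier B) {Y : Set ℕ}
    (hYB : Y ⊆ barrierBase B) (hY : Y.Infinite) : IsBarrier (barrierRestrict B Y) where
  infinite hfin := by
    have hu : (⋃ s ∈ barrierRestrict B Y, (s : Set ℕ)).Finite :=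
      hfin.biUnion fun s _ => s.finite_toSet
    obtain ⟨s, hs, hsX⟩ := hB.exists_initial _ (Set.sdiff_subset.trans hYB) (hY.sdiff hu)
    obtain ⟨a, ha⟩ := hB.nonempty_of_mem hs
    exact (hsX.1 ha).2 (Set.mem_biUnion (show s ∈ barrierRestrict B Y from
      ⟨hs, hsX.1.trans Set.sdiff_subset⟩) ha)
  antichain := hB.antichain.subset fun _ h => h.1
  exists_initial X hX hi := by
    have hXY : X ⊆ Y := hX.trans (Set.iUnion₂_subset fun s hs => hs.2)
    obtain ⟨s, hs, hsX⟩ := hB.exists_initial X (hXY.trans hYB) hi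
    exact ⟨s, ⟨hs, hsX.1.trans hXY⟩, hsX⟩

theorem BarrierTypeLE.mono {B C : Set (Finset ℕ)} {α : Ordinal.{0}} (h : BarrierTypeLE B α)
    (hCB : C ⊆ B) : BarrierTypeLE C α := by
  obtain ⟨hw, hα⟩ := h
  let e : barrierLex C ↪r barrierLex B :=
    ⟨⟨Set.inclusion hCB, Set.inclusion_injective hCB⟩, Iff.rfl⟩
  have hC := e.isWellOrder
  exact ⟨hC, (Ordinal.type_le_iff'.2 ⟨e⟩).trans hα⟩

theorem ShiftExtends.isInitialSegment_left {r s : Finset ℕ} (h : ShiftExtends r s) :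
    IsInitialSegment r ((r ∪ s : Finset ℕ) : Set ℕ) := by
  obtain ⟨hr, hs, hlt, hi, -⟩ := h
  refine ⟨by simp, fun x hx y hy hxy => ?_⟩
  rcases Finset.mem_union.1 (Finset.mem_coe.1 hx) with hx | hx
  · exact hx
  · have hne : y ≠ r.min' hr := fun h => by
      have := s.min'_le x hx
      omega
    exact Finset.mem_of_mem_erase (hi.2 x hx y (Finset.mem_erase.2 ⟨hne, hy⟩) hxy)

theorem ShiftExtends.coe_union_diff {r s : Finset ℕ} (h : ShiftExtends r s) (hr : r.Nonempty) :
    ((r ∪ s : Finset ℕ) : Set ℕ) \ {r.min' hr} = s := by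
  obtain ⟨hr, hs, hlt, hi, -⟩ := h
  ext x
  simp only [Finset.coe_union, Set.mem_sdiff, Set.mem_union, Finset.mem_coe, Set.mem_singleton_iff]
  refine ⟨fun ⟨hx, hne⟩ => hx.elim (fun hx => hi.1 ?_) id, fun hx => ⟨Or.inr hx, ?_⟩⟩
  · exact Finset.mem_coe.2 (Finset.mem_erase.2 ⟨hne, hx⟩)
  · have := s.min'_le x hx
    omega

/-- In a barrier, the pair `s ◁ t` can be recovered from any set having `s ∪ t` as an initial
segment. -/
theorem IsBarrier.shiftExtends_unique {B : Set (Finset ℕ)} (hB : IsBarrier B)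
    {s t s' t' : Finset ℕ} (hs : s ∈ B) (ht : t ∈ B) (hs' : s' ∈ B) (ht' : t' ∈ B)
    (h : ShiftExtends s t) (h' : ShiftExtends s' t') {Z : Set ℕ}
    (hZ : IsInitialSegment (s ∪ t) Z) (hZ' : IsInitialSegment (s' ∪ t') Z) : s = s' ∧ t = t' := by
  obtain rfl := hB.eq_of_isInitialSegment hs hs' (h.isInitialSegment_left.trans hZ)
    (h'.isInitialSegment_left.trans hZ')
  refine ⟨rfl, ?_⟩
  have hne := hB.nonempty_of_mem hs
  have key {v : Finset ℕ} (hv : ShiftExtends s v) (hvZ : IsInitialSegment (s ∪ v) Z) :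
      IsInitialSegment v (Z \ {s.min' hne}) := by
    have hd := hv.coe_union_diff hne
    refine ⟨hd ▸ Set.sdiff_subset_sdiff_left hvZ.1, fun x hx y hy hxy => ?_⟩
    rw [← Finset.mem_coe, ← hd]
    exact ⟨hvZ.2 x hx.1 y (Finset.mem_union_right _ hy) hxy, hx.2⟩
  exact hB.eq_of_isInitialSegment ht ht' (key h hZ) (key h' hZ')

theorem IsBarrier.exists_shiftExtends {B : Set (Finset ℕ)} (hB : IsBarrier B) :
    ∃ s ∈ B, ∃ t ∈ B, ShiftExtends s t := by
  set X := barrierBase B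
  have hX : X.Infinite := hB.infinite_base
  obtain ⟨s, hs, hsX⟩ := hB.exists_initial X subset_rfl hX
  have hne := hB.nonempty_of_mem hs
  set m := s.min' hne
  have hm : ∀ x ∈ X, m ≤ x := fun x hx => by
    by_contra! h
    exact absurd (s.min'_le x (hsX.2 x hx m (s.min'_mem hne) h.le)) (not_le.2 h)
  obtain ⟨t, ht, htX⟩ := hB.exists_initial (X \ {m}) Set.sdiff_subset
    (hX.sdiff (Set.finite_singleton m))
  have hnt := hB.nonempty_of_mem ht
  have hst : ¬ t ⊆ s.erase m := fun h => by
    have := hB.antichain.eq ht hs (h.trans (s.erase_subset m))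
    exact s.notMem_erase m (h (this ▸ s.min'_mem hne))
  have hse : IsInitialSegment (s.erase m) (X \ {m}) := by
    refine ⟨fun x hx => ?_, fun x hx y hy hxy => ?_⟩
    · have := Finset.mem_erase.1 (Finset.mem_coe.1 hx)
      exact ⟨hsX.1 this.2, this.1⟩
    · exact Finset.mem_erase.2 ⟨hx.2, hsX.2 x hx.1 y (Finset.mem_of_mem_erase hy) hxy⟩
  refine ⟨s, hs, t, ht, hne, hnt, ?_, ⟨?_, fun x hx y hy hxy => hse.2 x (htX.1 hx) y hy hxy⟩, ?_⟩
  · have := htX.1 (t.min'_mem hnt)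
    exact lt_of_le_of_ne (hm _ this.1) fun h => this.2 h.symm
  · exact_mod_cast (hse.subset_or_subset htX).resolve_right hst
  · exact fun h => hst h.ge

/-! ### Closure properties of better quasi orders -/

section Bqo

universe v

/-- A type mapped into a bqo by an order-reflecting (not necessarily monotone) map is bqo. Since a
monotone surjection has an order-reflecting section, this also covers monotone images. -/
theorem IsBqo.of_reflecting {P : Type u} {Q : Type v} [LE P] [LE Q] (hQ : IsBqo Q) (f : P → Q)
    (hf : ∀ x y, f x ≤ f y → x ≤ y) : IsBqo P := fun α hα B hB hBα g => by
  obtain ⟨s, t, hst, h⟩ := hQ α hα B hB hBα (f ∘ g)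
  exact ⟨s, t, hst, hf _ _ h⟩

theorem isBqo_of_forall_le {P : Type u} [LE P] (h : ∀ x y : P, x ≤ y) : IsBqo P :=
  fun _ _ B hB _ f => by
    obtain ⟨s, hs, t, ht, hst⟩ := hB.exists_shiftExtends
    exact ⟨⟨s, hs⟩, ⟨t, ht⟩, hst, h _ _⟩

/-- The product of two bqos is bqo: by the partition theorem, the first coordinate of a map from a
barrier may be assumed to increase along all pairs `s ◁ t`, or along none of them. -/
theorem IsBqo.prod {P : Type u} {Q : Type v} [LE P] [LE Q] (hP : IsBqo P) (hQ : IsBqo Q) :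
    IsBqo (P × Q) := fun α hα B hB hBα f => by
  -- the unions of the pairs `s ◁ t` along which the first coordinate increases
  let F : Set (Finset ℕ) := {u | ∃ s t : B, ShiftExtends s.1 t.1 ∧ (f s).1 ≤ (f t).1 ∧
    u = s.1 ∪ t.1}
  obtain ⟨Y, hYB, hY, hhom⟩ := exists_infinite_homogeneous F hB.infinite_base
  have hBY := hB.restrict hYB hY
  have hsub : barrierRestrict B Y ⊆ B := fun _ h => h.1
  have hαY := hBα.mono hsub
  have hZsub (s t : barrierRestrict B Y) :
      ((s.1 ∪ t.1 : Finset ℕ) : Set ℕ) ∪ elementsAbove (s.1 ∪ t.1) Y ⊆ Y := by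
    refine Set.union_subset ?_ (elementsAbove_subset _ _)
    rw [Finset.coe_union]
    exact Set.union_subset s.2.2 t.2.2
  have hZinf (u : Finset ℕ) : ((u : Set ℕ) ∪ elementsAbove u Y).Infinite :=
    (hY.elementsAbove u).mono Set.subset_union_right
  rcases hhom with hhom | hhom
  -- the first coordinate cannot be bad on the restriction of `B` to `Y`
  · obtain ⟨s, t, hst, h⟩ := hP α hα _ hBY hαY fun s => (f (Set.inclusion hsub s)).1
    exact absurd ⟨_, ⟨_, _, hst, h, rfl⟩, isInitialSegment_union_elementsAbove _ Y⟩
      (hhom _ (hZsub s t) (hZinf _))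
  -- on the restriction of `B` to `Y`, the first coordinate increases along every pair `s ◁ t`
  · obtain ⟨s, t, hst, h⟩ := hQ α hα _ hBY hαY fun s => (f (Set.inclusion hsub s)).2
    obtain ⟨_, ⟨s', t', hst', h', rfl⟩, hi⟩ := hhom _ (hZsub s t) (hZinf _)
    obtain ⟨hs, ht⟩ := hB.shiftExtends_unique s.2.1 t.2.1 s'.2 t'.2 hst hst'
      (isInitialSegment_union_elementsAbove _ Y) hi
    have hs : Set.inclusion hsub s = s' := Subtype.ext hs
    have ht : Set.inclusion hsub t = t' := Subtype.ext ht
    exact ⟨s', t', hst', h', hs ▸ ht ▸ h⟩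

theorem IsBqo.isSigmaBqo {P : Type u} [LE P] (h : IsBqo P) : IsSigmaBqo P :=
  ⟨fun _ => Set.univ, Set.iUnion_const _, fun _ => h.of_reflecting Subtype.val fun _ _ h => h⟩

theorem isSigmaBqo_of_countable_cover {P : Type u} [LE P] {ι : Type v} [Countable ι]
    (S : ι → Set P) (hS : ∀ x, ∃ i, x ∈ S i) (h : ∀ i, IsBqo (S i)) : IsSigmaBqo P := by
  rcases isEmpty_or_nonempty ι with hι | hι
  · have : IsEmpty P := ⟨fun x => (hS x).elim fun i _ => hι.elim i⟩
    exact (isBqo_of_forall_le fun x => this.elim x).isSigmaBqo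
  · obtain ⟨e, he⟩ := exists_surjective_nat ι
    refine ⟨S ∘ e, Set.eq_univ_of_forall fun x => ?_, fun n => h (e n)⟩
    obtain ⟨i, hi⟩ := hS x
    obtain ⟨n, rfl⟩ := he i
    exact Set.mem_iUnion.2 ⟨n, hi⟩

theorem IsSigmaBqo.of_reflecting {P : Type u} {Q : Type v} [LE P] [LE Q] (hQ : IsSigmaBqo Q)
    (f : P → Q) (hf : ∀ x y, f x ≤ f y → x ≤ y) : IsSigmaBqo P := by
  obtain ⟨S, hS, h⟩ := hQ
  refine ⟨fun n => f ⁻¹' S n, by rw [← Set.preimage_iUnion, hS, Set.preimage_univ], fun n => ?_⟩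
  exact (h n).of_reflecting (fun x => ⟨f x.1, x.2⟩) fun x y hxy => hf _ _ hxy

theorem IsSigmaBqo.prod {P : Type u} {Q : Type v} [LE P] [LE Q] (hP : IsSigmaBqo P)
    (hQ : IsSigmaBqo Q) : IsSigmaBqo (P × Q) := by
  obtain ⟨S, hS, h⟩ := hP
  obtain ⟨T, hT, k⟩ := hQ
  refine isSigmaBqo_of_countable_cover (fun i : ℕ × ℕ => S i.1 ×ˢ T i.2) (fun x => ?_) fun i => ?_
  · obtain ⟨m, hm⟩ := Set.mem_iUnion.1 (hS ▸ Set.mem_univ x.1)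
    obtain ⟨n, hn⟩ := Set.mem_iUnion.1 (hT ▸ Set.mem_univ x.2)
    exact ⟨(m, n), hm, hn⟩
  · exact ((h i.1).prod (k i.2)).of_reflecting
      (fun x => (⟨x.1.1, x.2.1⟩, ⟨x.1.2, x.2.2⟩)) fun _ _ hxy => hxy

theorem isSigmaBqo_of_countable_union {P : Type u} [LE P] {ι : Type v} [Countable ι]
    (S : ι → Set P) (hS : ∀ x, ∃ i, x ∈ S i) (h : ∀ i, IsSigmaBqo (S i)) : IsSigmaBqo P := by
  choose T hT hb using h
  refine isSigmaBqo_of_countable_cover (fun i : ι × ℕ => Subtype.val '' T i.1 i.2) (fun x => ?_)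
    fun i => ?_
  · obtain ⟨i, hi⟩ := hS x
    obtain ⟨n, hn⟩ := Set.mem_iUnion.1 (hT i ▸ Set.mem_univ (⟨x, hi⟩ : S i))
    exact ⟨(i, n), _, hn, rfl⟩
  · have hm (x : Subtype.val '' T i.1 i.2) : ∃ y : T i.1 i.2, y.1.1 = x.1 := by
      obtain ⟨_, y, hy, rfl⟩ := x
      exact ⟨⟨y, hy⟩, rfl⟩
    choose g hg using hm
    refine (hb i.1 i.2).of_reflecting g fun x y hxy => ?_
    rw [← Subtype.coe_le_coe, ← hg x, ← hg y]
    exact hxy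

theorem IsSigmaBqo.fin_pi {Q : Type u} [LE Q] (hQ : IsSigmaBqo Q) (k : ℕ) :
    IsSigmaBqo (Fin k → Q) := by
  induction k with
  | zero => exact (isBqo_of_forall_le fun _ _ i => i.elim0).isSigmaBqo
  | succ k ih =>
    exact (hQ.prod ih).of_reflecting (fun f => (f 0, fun i => f i.succ)) fun f g h i =>
      Fin.cases h.1 h.2 i

/-- In a well quasi order, every lower set is the complement of the upper closure of finitely many
elements. -/
theorem LowerSet.exists_fin_compl_basis {Q : Type u} [PartialOrder Q] [WellQuasiOrderedLE Q]
    (J : LowerSet Q) : ∃ (k : ℕ) (f : Fin k → Q), ∀ x, x ∈ J ↔ ∀ i, ¬ f i ≤ x := by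
  have hfin : {x | Minimal (· ∉ J) x}.Finite :=
    WellQuasiOrderedLE.finite_of_isAntichain (setOfPred_minimal_antichain _)
  obtain ⟨k, f, -, hf⟩ := hfin.fin_param
  refine ⟨k, f, fun x => ⟨fun hx i hi => ?_, fun h => ?_⟩⟩
  · have h : f i ∈ {x | Minimal (· ∉ J) x} := hf ▸ Set.mem_range_self i
    have h : Minimal (· ∉ J) (f i) := h
    exact h.prop (J.lower hi hx)
  · by_contra hx
    obtain ⟨m, hmx, hm⟩ := exists_minimal_le_of_wellFoundedLT (· ∉ J) x hx
    obtain ⟨i, rfl⟩ : m ∈ Set.range f := hf ▸ hm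
    exact h i hmx

/-- The lower sets of a `σ`-bqo well quasi order form a `σ`-bqo: lower sets whose complements are
generated by `k` elements are compared through the corresponding `k`-tuples. -/
theorem IsSigmaBqo.lowerSet {Q : Type u} [PartialOrder Q] [WellQuasiOrderedLE Q]
    (hQ : IsSigmaBqo Q) : IsSigmaBqo (LowerSet Q) := by
  refine isSigmaBqo_of_countable_union
    (fun k : ℕ => {J : LowerSet Q | ∃ f : Fin k → Q, ∀ x, x ∈ J ↔ ∀ i, ¬ f i ≤ x})
    (fun J => J.exists_fin_compl_basis) fun k => ?_
  choose f hf using fun J : {J : LowerSet Q | ∃ f : Fin k → Q, ∀ x, x ∈ J ↔ ∀ i, ¬ f i ≤ x} => J.2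
  refine (hQ.fin_pi k).of_reflecting f fun J K h => ?_
  intro x hx
  exact (hf K x).2 fun i hi => (hf J x).1 hx i ((h i).trans hi)

end Bqo

/-! ### Compactness of embeddings between well-ordered sequences -/

/-- A sequence `s` embeds into `t` as soon as all its proper initial segments do: sending `i` to the
least value that embeddings of the part of `s` up to `i` take at `i` defines an embedding of `s`. -/
theorem seqEmbeds_of_forall_initial {P : Type u} [LE P] {β γ : Ordinal.{0}} (s : Set.Iio β → P)
    (t : Set.Iio γ → P)
    (h : ∀ j, ∃ ρ : Set.Iio β → Set.Iio γ, StrictMonoOn ρ (Set.Iic j) ∧ ∀ i ≤ j, s i ≤ t (ρ i)) :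
    SeqEmbeds s t := by
  have hmin (j) : ∃ ρ : Set.Iio β → Set.Iio γ,
      (StrictMonoOn ρ (Set.Iic j) ∧ ∀ i ≤ j, s i ≤ t (ρ i)) ∧ ∀ σ : Set.Iio β → Set.Iio γ,
        (StrictMonoOn σ (Set.Iic j) ∧ ∀ i ≤ j, s i ≤ t (σ i)) → ρ j ≤ σ j := by
    obtain ⟨ρ, hρ, hmin⟩ := WellFounded.has_min (InvImage.wf (fun ρ => ρ j) wellFounded_lt)
      {ρ : Set.Iio β → Set.Iio γ | StrictMonoOn ρ (Set.Iic j) ∧ ∀ i ≤ j, s i ≤ t (ρ i)} (h j)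
    exact ⟨ρ, hρ, fun σ hσ => not_lt.1 (hmin σ hσ)⟩
  choose ρ hρ hmin using hmin
  refine ⟨fun j => ρ j j, fun i j hij => ?_, fun j => (hρ j).2 j le_rfl⟩
  have hi : StrictMonoOn (ρ j) (Set.Iic i) := (hρ j).1.mono (Set.Iic_subset_Iic.2 hij.le)
  exact (hmin i (ρ j) ⟨hi, fun k hk => (hρ j).2 k (hk.trans hij.le)⟩).trans_lt
    ((hρ j).1 hij.le Set.self_mem_Iic hij)

/-! ### Well quasi ordering of shorter sequences -/

section Padding

variable {P : Type u}

/-- The least position from which on all terms of `s` are equal to `w`. -/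
noncomputable def coreLength (w : P) {γ : Ordinal.{0}} (s : Set.Iio γ → P) : Ordinal.{0} :=
  sInf {η : Ordinal.{0} | ∀ i : Set.Iio γ, η ≤ i.1 → s i = w}

theorem coreLength_spec (w : P) {γ : Ordinal.{0}} (s : Set.Iio γ → P) (i : Set.Iio γ)
    (hi : coreLength w s ≤ i.1) : s i = w :=
  csInf_mem (s := {η : Ordinal.{0} | ∀ i : Set.Iio γ, η ≤ i.1 → s i = w})
    ⟨γ, fun i hi => absurd i.2 (not_lt.2 hi)⟩ i hi

theorem coreLength_le_of_forall {w : P} {γ : Ordinal.{0}} {s : Set.Iio γ → P} {η : Ordinal.{0}}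
    (h : ∀ i : Set.Iio γ, η ≤ i.1 → s i = w) : coreLength w s ≤ η :=
  csInf_le' h

theorem coreLength_le (w : P) {γ : Ordinal.{0}} (s : Set.Iio γ → P) : coreLength w s ≤ γ :=
  coreLength_le_of_forall fun i hi => absurd i.2 (not_lt.2 hi)

open Classical in
/-- The sequence of length `α` obtained from `s` by continuing it with the constant value `w`. -/
noncomputable def padSeq (w : P) {γ : Ordinal.{0}} (s : Set.Iio γ → P) (α : Ordinal.{0}) :
    OrdSeq P α :=
  ⟨fun i => if h : i.1 < γ then s ⟨i, h⟩ else w⟩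

theorem padSeq_val_of_lt (w : P) {γ α : Ordinal.{0}} (s : Set.Iio γ → P) (i : Set.Iio α)
    (h : i.1 < γ) : (padSeq w s α).val i = s ⟨i, h⟩ :=
  dif_pos h

theorem padSeq_val_eq (w : P) {γ α : Ordinal.{0}} (s : Set.Iio γ → P) (i : Set.Iio α)
    (h : coreLength w s ≤ i.1) : (padSeq w s α).val i = w := by
  by_cases hi : i.1 < γ
  · rw [padSeq_val_of_lt w s i hi]
    exact coreLength_spec w s _ h
  · exact dif_neg hi

/-- If `w` is minimal, an embedding of padded sequences cannot send a term before the core length of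
`s` beyond the core length of `t`, because all later terms of `s` would then be equal to `w`. -/
theorem seqEmbeds_of_padSeq_le [PartialOrder P] {w : P} (hw : ∀ x ≤ w, x = w) {α γ δ : Ordinal.{0}}
    (hγ : γ ≤ α) {s : Set.Iio γ → P} {t : Set.Iio δ → P}
    (h : padSeq w s α ≤ padSeq w t α)
    (hl : γ - coreLength w s ≤ δ - coreLength w t) : SeqEmbeds s t := by
  classical
  obtain ⟨ρ, hρ, hle⟩ := h
  set η := coreLength w s
  set θ := coreLength w t
  have hη : η ≤ γ := coreLength_le w s
  have hθ : θ ≤ δ := coreLength_le w t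
  have hcore (i : Set.Iio α) (hi : i.1 < η) : (ρ i).1 < θ := by
    by_contra! hθi
    refine absurd hi (not_lt.2 (coreLength_le_of_forall fun j hij => ?_))
    have hj : j.1 < α := lt_of_lt_of_le j.2 hγ
    have h₁ := hle ⟨j, hj⟩
    rw [padSeq_val_of_lt w s ⟨j, hj⟩ j.2, padSeq_val_eq w t] at h₁
    · exact hw _ h₁
    · exact hθi.trans (hρ.monotone (show i ≤ ⟨j, hj⟩ from hij))
  have hα (i : Set.Iio γ) : i.1 < α := lt_of_lt_of_le i.2 hγ
  -- follow `ρ` below the core length of `s`, and shift the tail of `s` onto that of `t`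
  let σ : Set.Iio γ → Ordinal.{0} := fun i =>
    if i.1 < η then (ρ ⟨i, hα i⟩).1 else θ + (i.1 - η)
  have hσ₁ (i : Set.Iio γ) (hi : i.1 < η) : σ i = (ρ ⟨i, hα i⟩).1 := if_pos hi
  have hσ₂ (i : Set.Iio γ) (hi : ¬ i.1 < η) : σ i = θ + (i.1 - η) := if_neg hi
  have hσ (i) : σ i < δ := by
    by_cases hi : i.1 < η
    · rw [hσ₁ i hi]
      exact (hcore _ hi).trans_le hθ
    · rw [hσ₂ i hi, ← Ordinal.add_sub_cancel_of_le hθ]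
      refine (add_lt_add_iff_left θ).2 (lt_of_lt_of_le ?_ hl)
      rw [← add_lt_add_iff_left η, Ordinal.add_sub_cancel_of_le (not_lt.1 hi),
        Ordinal.add_sub_cancel_of_le hη]
      exact i.2
  refine ⟨fun i => ⟨σ i, hσ i⟩, fun i j hij => ?_, fun i => ?_⟩
  · change σ i < σ j
    by_cases hj : j.1 < η
    · rw [hσ₁ j hj, hσ₁ i (lt_trans hij hj)]
      exact hρ (show (⟨i, hα i⟩ : Set.Iio α) < ⟨j, hα j⟩ from hij)
    · rw [hσ₂ j hj]
      by_cases hi : i.1 < η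
      · rw [hσ₁ i hi]
        exact (hcore _ hi).trans_le le_self_add
      · rw [hσ₂ i hi, add_lt_add_iff_left, ← add_lt_add_iff_left η,
          Ordinal.add_sub_cancel_of_le (not_lt.1 hi), Ordinal.add_sub_cancel_of_le (not_lt.1 hj)]
        exact hij
  · by_cases hi : i.1 < η
    · have h₁ := hle ⟨i, hα i⟩
      have hρi : (ρ ⟨i, hα i⟩).1 < δ := (hcore ⟨i, hα i⟩ hi).trans_le hθ
      rw [padSeq_val_of_lt w s ⟨i, hα i⟩ i.2, padSeq_val_of_lt w t _ hρi] at h₁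
      exact h₁.trans_eq (congrArg t (Subtype.ext (hσ₁ i hi).symm))
    · rw [coreLength_spec w s i (not_lt.1 hi), coreLength_spec w t]
      change θ ≤ σ i
      rw [hσ₂ i hi]
      exact le_self_add

theorem wellQuasiOrderedLE_of_reflecting {Q : Type*} {R : Type*} [LE Q] [LE R]
    [hR : WellQuasiOrderedLE R] (f : Q → R) (hf : ∀ x y, f x ≤ f y → x ≤ y) :
    WellQuasiOrderedLE Q :=
  ⟨fun g => by
    obtain ⟨m, n, hmn, h⟩ := hR.wqo (f ∘ g)
    exact ⟨m, n, hmn, hf _ _ h⟩⟩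

/-- If `P^α` is wqo, then so is `P^{<α}`: a sequence is determined up to equivalence by its padding
to length `α` with a minimal element `w` of `P` and by the length of its maximal tail with constant
value `w`. -/
theorem wellQuasiOrderedLE_ordSeqLT [PartialOrder P] {α : Ordinal.{0}} (hα : 1 ≤ α)
    [WellQuasiOrderedLE (OrdSeq P α)] : WellQuasiOrderedLE (OrdSeqLT P α) := by
  have hP : WellQuasiOrderedLE P :=
    wellQuasiOrderedLE_of_reflecting (fun p => (⟨fun _ => p⟩ : OrdSeq P α)) fun p q h => by
      obtain ⟨ρ, -, h⟩ := h
      exact h ⟨0, zero_lt_one.trans_le hα⟩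
  rcases isEmpty_or_nonempty P with hE | hne
  · have hle (s t : OrdSeqLT P α) : s ≤ t := by
      have : IsEmpty (Set.Iio s.length) := ⟨fun i => hE.elim (s.val i)⟩
      exact ⟨fun i => isEmptyElim i, fun i => isEmptyElim i, fun i => isEmptyElim i⟩
    exact ⟨fun f => ⟨0, 1, zero_lt_one, hle _ _⟩⟩
  · obtain ⟨w, -, hw⟩ := WellFounded.has_min (wellFounded_lt (α := P)) Set.univ Set.univ_nonempty
    refine wellQuasiOrderedLE_of_reflecting (R := OrdSeq P α × Ordinal.{0})
      (fun s => (padSeq w s.val α, s.length - coreLength w s.val)) fun s t h => ?_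
    refine seqEmbeds_of_padSeq_le (fun x hx => ?_) s.length_lt.le h.1 h.2
    exact hx.eq_of_not_lt (hw x trivial)

end Padding

/-! ### The `σ`-bqo property for powers -/

theorem countable_Iio_of_lt_omega_one {α : Ordinal.{0}} (h : α < ω₁) : Countable (Set.Iio α) := by
  rw [← Cardinal.ord_aleph, Cardinal.lt_ord, ← Cardinal.succ_aleph0, Order.lt_succ_iff] at h
  rw [← Cardinal.mk_le_aleph0_iff, Cardinal.mk_Iio_ordinal]
  exact Cardinal.lift_le_aleph0.2 h

/-- The lower set of `P^{<γ}` consisting of the classes of the sequences that embed into `s`. -/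
noncomputable def initialPart {P : Type u} [Preorder P] {γ : Ordinal.{0}} (s : OrdSeq P γ) :
    LowerSet (OrdPowLT P γ) where
  carrier := {x | SeqEmbeds (ofAntisymmetrization (· ≤ ·) x).val s.val}
  lower' _ _ hyx hx := SeqEmbeds.trans (ofAntisymmetrization_le_ofAntisymmetrization_iff.2 hyx) hx

theorem mk_mem_initialPart {P : Type u} [Preorder P] {γ : Ordinal.{0}} (s : OrdSeq P γ)
    (x : OrdSeqLT P γ) :
    toAntisymmetrization (· ≤ ·) x ∈ initialPart s ↔ SeqEmbeds x.val s.val := by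
  have h : ofAntisymmetrization (· ≤ ·) (toAntisymmetrization (· ≤ ·) x) ≤ x ∧
      x ≤ ofAntisymmetrization (· ≤ ·) (toAntisymmetrization (· ≤ ·) x) := by
    have h := toAntisymmetrization_ofAntisymmetrization (· ≤ ·) (toAntisymmetrization (· ≤ ·) x)
    exact ⟨toAntisymmetrization_le_toAntisymmetrization_iff.1 h.le,
      toAntisymmetrization_le_toAntisymmetrization_iff.1 h.ge⟩
  exact ⟨fun hx => SeqEmbeds.trans h.2 hx, fun hx => SeqEmbeds.trans h.1 hx⟩

/-- By compactness, a sequence of limit length is determined by its proper initial segments. -/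
theorem le_of_initialPart_le {P : Type u} [Preorder P] {γ : Ordinal.{0}} (hγ : Order.IsSuccLimit γ)
    {s t : OrdSeq P γ} (h : initialPart s ≤ initialPart t) : s ≤ t := by
  refine seqEmbeds_of_forall_initial s.val t.val fun j => ?_
  have hj : Order.succ j.1 < γ := hγ.succ_lt j.2
  let x : OrdSeqLT P γ := ⟨Order.succ j.1, hj, fun i => s.val ⟨i, lt_trans i.2 hj⟩⟩
  have hx : toAntisymmetrization (· ≤ ·) x ∈ initialPart s :=
    (mk_mem_initialPart s x).2 ⟨fun i => ⟨i, lt_trans i.2 hj⟩, fun _ _ h => h, fun _ => le_rfl⟩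
  obtain ⟨ρ, hρ, hle⟩ := (mk_mem_initialPart t x).1 (h hx)
  have hlt (i : Set.Iio γ) (hi : i ≤ j) : i.1 < Order.succ j.1 :=
    Order.lt_succ_iff.2 (Subtype.coe_le_coe.2 hi)
  classical
  refine ⟨fun i => if hi : i ≤ j then ρ ⟨i.1, hlt i hi⟩ else j, fun i hi k hk hik => ?_,
    fun i hi => ?_⟩
  · simp only [dif_pos (Set.mem_Iic.1 hi), dif_pos (Set.mem_Iic.1 hk)]
    exact hρ hik
  · simp only [dif_pos hi]
    exact hle ⟨i.1, hlt i hi⟩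

theorem isSigmaBqo_antisymmetrization {Q : Type u} [Preorder Q] (h : IsSigmaBqo Q) :
    IsSigmaBqo (Antisymmetrization Q (· ≤ ·)) :=
  h.of_reflecting (ofAntisymmetrization (· ≤ ·)) fun _ _ =>
    ofAntisymmetrization_le_ofAntisymmetrization_iff.1

theorem isSigmaBqo_ordSeqLT {P : Type u} [Preorder P] {γ : Ordinal.{0}} (hγ : γ < ω₁)
    (h : ∀ δ < γ, IsSigmaBqo (OrdSeq P δ)) : IsSigmaBqo (OrdSeqLT P γ) := by
  have := countable_Iio_of_lt_omega_one hγ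
  refine isSigmaBqo_of_countable_union (fun δ : Set.Iio γ => {s | s.length = δ})
    (fun s => ⟨⟨s.length, s.length_lt⟩, rfl⟩) fun δ => ?_
  have hmk (s : {s : OrdSeqLT P γ | s.length = δ}) :
      ∃ t : OrdSeq P δ, (⟨δ, δ.2, t.val⟩ : OrdSeqLT P γ) = s := by
    obtain ⟨⟨l, hl, v⟩, rfl : l = δ⟩ := s
    exact ⟨⟨v⟩, rfl⟩
  choose f hf using hmk
  refine (h δ δ.2).of_reflecting f fun s t hst => ?_
  rw [← Subtype.coe_le_coe, ← hf s, ← hf t]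
  exact hst

theorem isSigmaBqo_ordSeq_succ {P : Type u} [Preorder P] (hP : IsSigmaBqo P) {δ : Ordinal.{0}}
    (h : IsSigmaBqo (OrdSeq P δ)) : IsSigmaBqo (OrdSeq P (Order.succ δ)) := by
  classical
  refine (h.prod hP).of_reflecting (fun s => (⟨fun i => s.val ⟨i, lt_trans i.2 (Order.lt_succ δ)⟩⟩,
    s.val ⟨δ, Order.lt_succ δ⟩)) fun s t ⟨⟨ρ, hρ, hle⟩, hδ⟩ => ?_
  refine ⟨fun i => if hi : i.1 < δ then ⟨ρ ⟨i, hi⟩, lt_trans (ρ ⟨i, hi⟩).2 (Order.lt_succ δ)⟩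
    else ⟨δ, Order.lt_succ δ⟩, fun i k hik => ?_, fun i => ?_⟩
  · have hi : i.1 < δ := lt_of_lt_of_le hik (Order.lt_succ_iff.1 k.2)
    by_cases hk : k.1 < δ
    · simp only [dif_pos hi, dif_pos hk]
      exact hρ (show (⟨i, hi⟩ : Set.Iio δ) < ⟨k, hk⟩ from hik)
    · simp only [dif_pos hi, dif_neg hk]
      exact (ρ ⟨i, hi⟩).2
  · by_cases hi : i.1 < δ
    · simp only [dif_pos hi]
      exact hle ⟨i, hi⟩
    · simp only [dif_neg hi]
      obtain rfl : i = ⟨δ, Order.lt_succ δ⟩ :=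
        Subtype.ext ((Order.lt_succ_iff.1 i.2).antisymm (not_lt.1 hi))
      exact hδ

/-- By induction on the length `γ ≤ α`: at a successor, split off the last term; at a limit, compare
sequences through the lower sets of shorter sequences that they determine. -/
theorem isSigmaBqo_ordSeq {P : Type u} [Preorder P] (hP : IsSigmaBqo P) {α : Ordinal.{0}}
    (hα : α < ω₁) [hw : WellQuasiOrderedLE (OrdSeqLT P α)] (γ : Ordinal.{0}) (hγ : γ ≤ α) :
    IsSigmaBqo (OrdSeq P γ) := by
  induction γ using Ordinal.limitRecOn with
  | zero =>
    have : IsEmpty (Set.Iio (0 : Ordinal.{0})) := ⟨fun i => not_lt_zero (Set.mem_Iio.1 i.2)⟩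
    have hle (s t : OrdSeq P 0) : s ≤ t :=
      ⟨fun i => isEmptyElim i, fun i => isEmptyElim i, fun i => isEmptyElim i⟩
    exact (isBqo_of_forall_le hle).isSigmaBqo
  | add_one δ ih =>
    rw [← Order.succ_eq_add_one] at hγ ⊢
    exact isSigmaBqo_ordSeq_succ hP (ih ((Order.le_succ δ).trans hγ))
  | limit γ hlim ih =>
    have hlt : IsSigmaBqo (OrdPowLT P γ) := isSigmaBqo_antisymmetrization <|
      isSigmaBqo_ordSeqLT (hγ.trans_lt hα) fun δ hδ => ih δ hδ (hδ.le.trans hγ)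
    have : WellQuasiOrderedLE (OrdPowLT P γ) := wellQuasiOrderedLE_of_reflecting
      (fun x => (⟨(ofAntisymmetrization (· ≤ ·) x).length,
        (ofAntisymmetrization (· ≤ ·) x).length_lt.trans_le hγ,
        (ofAntisymmetrization (· ≤ ·) x).val⟩ : OrdSeqLT P α))
      fun _ _ h => ofAntisymmetrization_le_ofAntisymmetrization_iff.1 h
    exact hlt.lowerSet.of_reflecting initialPart fun _ _ h => le_of_initialPart_le hlim h

theorem mainTheorem2 {P : Type u} [PartialOrder P] (α : Ordinal.{0}) (hα : 1 ≤ α) (hα' : α < ω₁)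
    (hP : IsSigmaBqo P) (hPα : WellQuasiOrderedLE (OrdPow P α)) :
    (WellQuasiOrderedLE (OrdPowLT P α) ∧ IsSigmaBqo (OrdPowLT P α)) ∧
      IsSigmaBqo (LowerSet (OrdPowLT P α)) ∧
      IsSigmaBqo (OrdPow P α) := by
  have : WellQuasiOrderedLE (OrdSeq P α) := wellQuasiOrderedLE_of_reflecting
    (toAntisymmetrization (· ≤ ·)) fun _ _ => toAntisymmetrization_le_toAntisymmetrization_iff.1
  have hw : WellQuasiOrderedLE (OrdSeqLT P α) := wellQuasiOrderedLE_ordSeqLT hα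
  have hpow (γ) (hγ : γ ≤ α) : IsSigmaBqo (OrdSeq P γ) := isSigmaBqo_ordSeq hP hα' γ hγ
  have hlt : IsSigmaBqo (OrdPowLT P α) := isSigmaBqo_antisymmetrization <|
    isSigmaBqo_ordSeqLT hα' fun δ hδ => hpow δ hδ.le
  have hwlt : WellQuasiOrderedLE (OrdPowLT P α) := wellQuasiOrderedLE_of_reflecting
    (ofAntisymmetrization (· ≤ ·)) fun _ _ => ofAntisymmetrization_le_ofAntisymmetrization_iff.1
  exact ⟨⟨hwlt, hlt⟩, hlt.lowerSet, isSigmaBqo_antisymmetrization (hpow α le_rfl)⟩
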